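/- **Setting.** A linear metro line (two directions joined at the two termini) is a closed loop of $n$ segments; segment $j$ joins node $j-1$ to node $j$, indices modulo $n$. Let $b_j\in\{0,1\}$ be the number of trains on segment $j$ at time zero, $\bar b_j=1-b_j$, and let $m=\sum_j b_j$ be the number of trains, with $0<m<n$. Let $\lambda_{ij}\ge 0$ be the passenger demand from platform $i$ to platform $j$ (zero if $i$ or $j$ is not a platform), $\alpha^{\rm in}_j,\alpha^{\rm out}_j>0$ the boarding and alighting rates, and $$x_j=\frac{\sum_i\lambda_{ij}}{\alpha^{\rm out}_j}+\frac{\sum_i\lambda_{ji}}{\alpha^{\rm in}_j}<1,\qquad X_j=\frac{x_j}{1-x_j}.$$ Let $\underline r_j\ge 0$ be the minimum run times, $\Delta r_j\ge 0$ the run time margins, $\tilde r_j=\underline r_j+\Delta r_j$ the nominal run times, $0\le\underline g_j\le\bar g_j$ the minimum and maximum dynamic intervals (from a departure from node $j$ to the next arrival there), and $\underline s_j\ge 0$ the minimum safe separation times, with $\sum_j(\underline g_jX_j+\tilde r_j)>0$ and $\sum_j\underline s_j>0$. Put $\underline h_j=\underline g_j/(1-x_j)$, $\bar h_j=\bar g_j/(1-x_j)$,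 $\underline w_j=x_j\underline h_j$, $\bar w_j=x_j\bar h_j$, $\Delta w_j=\bar w_j-\underline w_j$. Let $d^k_j$ be the time of the $k$-th departure from node $j$ and, for $k\ge1$, $h^k_j=d^k_j-d^{k-1}_j$. The *asymptotic average frequency* of $(d^k)_{k\ge0}$ is $1/h$ if $\lim_{k\to\infty}d^k_j/k=h>0$ for all $j$, with the same $h$ (the asymptotic average headway). **Statement.** Let $$f(m,X)=\min\left\{\frac{m}{\sum_j(\underline g_jX_j+\tilde r_j)},\ \frac1{\max_j(\underline g_jX_j+\tilde r_j+\underline s_j)},\ \frac{n-m}{\sum_j\underline s_j}\right\}.$$ 1. Every solution, from any initial state $d^0$, of the max-plus linear system $$d^k_j=\max\{d^{k-b_j}_{j-1}+\tilde r_j+X_j\underline g_j,\ d^{k-\bar b_{j+1}}_{j+1}+\underline s_{j+1}\},\qquad k\ge1,$$ has the asymptotic average frequency $f(m,X)$. 2. Suppose $\Delta r_j\ge\Delta w_j$ for all $j$. Consider the dynamics with demand-dependent dwell times and controlled run times $$d^k_j=\max\{d^{k-b_j}_{j-1}+r_j(h^k_j)+w_j(h^k_j),\ d^{k-\bar b_{j+1}}_{j+1}+\underline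 s_{j+1}\},\qquad k\ge1,$$ $$w_j(h)=\min\{x_jh,\bar w_j\},\qquad r_j(h)=\max\{\underline r_j,\ \underline r_j+\Delta r_j-x_j(h-\underline h_j)\}.$$ Every solution whose initial headways satisfy $h^1_j\le\bar h_i$ for all nodes $j$ and all nodes $i$ with $x_i>0$ and $\Delta r_i>\Delta w_i$ has the asymptotic average frequency $f(m,X)$. -/

import Mathlib

open Filter Topology

noncomputable section

/-- Data of a linear metro line discretized into `n` segments. The two directions of the line,
joined at the two termini, form a closed loop: segment `j` joins node `j - 1` to node `j`, with
indices modulo `n`. -/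
structure MetroLine (n : ℕ) where
  /-- whether there is a train on segment `j` at time zero -/
  occupied : ZMod n → Bool
  /-- origin-destination demand: passenger rate from platform `i` to platform `j` -/
  demand : ZMod n → ZMod n → ℝ
  /-- average boarding rate at a platform -/
  alphaIn : ZMod n → ℝ
  /-- average alighting rate at a platform -/
  alphaOut : ZMod n → ℝ
  /-- minimum run time on a segment -/
  rMin : ZMod n → ℝ
  /-- run time margin on a segment -/
  dr : ZMod n → ℝ
  /-- minimum dynamic interval at a node (from a departure to the next arrival) -/
  gMin : ZMod n → ℝ
  /-- maximum dynamic interval at a node -/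
  gMax : ZMod n → ℝ
  /-- minimum safe separation time on a segment -/
  s : ZMod n → ℝ

namespace MetroLine

/-- `1` if segment `j` carries a train at time zero, `0` otherwise. -/
def b {n : ℕ} (L : MetroLine n) (j : ZMod n) : ℕ := if L.occupied j then 1 else 0

/-- `1 - b j`, with `b j` either `0` or `1`. -/
def bBar {n : ℕ} (L : MetroLine n) (j : ZMod n) : ℕ := if L.occupied j then 0 else 1

/-- The number `m` of trains on the line. -/
def trains {n : ℕ} [NeZero n] (L : MetroLine n) : ℕ := ∑ j, L.b j

/-- Average passenger arrival rate at origin platform `i`. -/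
def lamIn {n : ℕ} [NeZero n] (L : MetroLine n) (i : ZMod n) : ℝ := ∑ j, L.demand i j

/-- Average passenger departure rate from destination platform `j`. -/
def lamOut {n : ℕ} [NeZero n] (L : MetroLine n) (j : ZMod n) : ℝ := ∑ i, L.demand i j

/-- Passenger demand parameter: `x j * h` is the time needed for alighting and boarding at `j`
after a headway `h`. It is zero at a node without platform. -/
def x {n : ℕ} [NeZero n] (L : MetroLine n) (j : ZMod n) : ℝ :=
  L.lamOut j / L.alphaOut j + L.lamIn j / L.alphaIn j

/-- `X = x / (1 - x)`. -/
def X {n : ℕ} [NeZero n] (L : MetroLine n) (j : ZMod n) : ℝ := L.x j / (1 - L.x j)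

/-- Nominal run time. -/
def rTilde {n : ℕ} (L : MetroLine n) (j : ZMod n) : ℝ := L.rMin j + L.dr j

/-- Minimum headway, the solution of `h = gMin + x * h`. -/
def hMin {n : ℕ} [NeZero n] (L : MetroLine n) (j : ZMod n) : ℝ := 1 / (1 - L.x j) * L.gMin j

/-- Maximum headway, the solution of `h = gMax + x * h`. -/
def hMax {n : ℕ} [NeZero n] (L : MetroLine n) (j : ZMod n) : ℝ := 1 / (1 - L.x j) * L.gMax j

/-- Minimum dwell time. -/
def wMin {n : ℕ} [NeZero n] (L : MetroLine n) (j : ZMod n) : ℝ := L.x j * L.hMin j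

/-- Maximum dwell time. -/
def wMax {n : ℕ} [NeZero n] (L : MetroLine n) (j : ZMod n) : ℝ := L.x j * L.hMax j

/-- Dwell time margin. -/
def dw {n : ℕ} [NeZero n] (L : MetroLine n) (j : ZMod n) : ℝ := L.wMax j - L.wMin j

/-- Demand-dependent dwell time at node `j` for a train with headway `h`. -/
def dwellTime {n : ℕ} [NeZero n] (L : MetroLine n) (j : ZMod n) (h : ℝ) : ℝ :=
  min (L.x j * h) (L.wMax j)

/-- Controlled run time on segment `j` for a train with headway `h`. -/
def runTime {n : ℕ} [NeZero n] (L : MetroLine n) (j : ZMod n) (h : ℝ) : ℝ :=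
  max (L.rMin j) (L.rMin j + L.dr j - L.x j * (h - L.hMin j))

/-- Travel time from node `j - 1` to node `j`: run time plus dwell time. -/
def travelTime {n : ℕ} [NeZero n] (L : MetroLine n) (j : ZMod n) (h : ℝ) : ℝ :=
  L.runTime j h + L.dwellTime j h

/-- The headway `d^k_j - d^(k-1)_j` (used for `k ≥ 1` only); `d k j` is the time of the `k`-th
departure from node `j`. -/
def headway {n : ℕ} (d : ℕ → ZMod n → ℝ) (k : ℕ) (j : ZMod n) : ℝ := d k j - d (k - 1) j

/-- Train dynamics with demand-dependent dwell times and controlled run times, started from `d 0`: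
a train departs as soon as the travel time constraint and the safe separation constraint are both
satisfied. The travel time depends on the headway of the departure itself. -/
def IsDemandTrajectory {n : ℕ} [NeZero n] (L : MetroLine n) (d : ℕ → ZMod n → ℝ) : Prop :=
  ∀ k : ℕ, 1 ≤ k → ∀ j : ZMod n,
    d k j = max (d (k - L.b j) (j - 1) + L.travelTime j (headway d k j))
      (d (k - L.bBar (j + 1)) (j + 1) + L.s (j + 1))

/-- The max-plus linear train dynamics, started from `d 0`. -/
def IsMaxPlusTrajectory {n : ℕ} [NeZero n] (L : MetroLine n) (d : ℕ → ZMod n → ℝ) : Prop :=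
  ∀ k : ℕ, 1 ≤ k → ∀ j : ZMod n,
    d k j = max (d (k - L.b j) (j - 1) + L.rTilde j + L.X j * L.gMin j)
      (d (k - L.bBar (j + 1)) (j + 1) + L.s (j + 1))

/-- Standing sign conditions on the parameters. The last two exclude only the degenerate lines
with zero total travel time or zero total separation time. -/
structure Admissible {n : ℕ} [NeZero n] (L : MetroLine n) : Prop where
  demand_nonneg : ∀ i j, 0 ≤ L.demand i j
  alphaIn_pos : ∀ j, 0 < L.alphaIn j
  alphaOut_pos : ∀ j, 0 < L.alphaOut j
  x_lt_one : ∀ j, L.x j < 1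
  rMin_nonneg : ∀ j, 0 ≤ L.rMin j
  dr_nonneg : ∀ j, 0 ≤ L.dr j
  gMin_nonneg : ∀ j, 0 ≤ L.gMin j
  gMin_le_gMax : ∀ j, L.gMin j ≤ L.gMax j
  s_nonneg : ∀ j, 0 ≤ L.s j
  sum_travel_pos : 0 < ∑ j, (L.gMin j * L.X j + L.rTilde j)
  sum_s_pos : 0 < ∑ j, L.s j

/-- The run time margin covers the dwell time margin on every segment. -/
def MarginCondition {n : ℕ} [NeZero n] (L : MetroLine n) : Prop := ∀ j, L.dw j ≤ L.dr j

/-- The initial headways do not exceed the maximum headway of any platform whose run time margin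
strictly exceeds its dwell time margin. (At the other nodes the travel time does not depend on the
headway, so that no bound is needed there.) -/
def InitialHeadwayCondition {n : ℕ} [NeZero n] (L : MetroLine n) (d : ℕ → ZMod n → ℝ) : Prop :=
  ∀ i, 0 < L.x i → L.dw i < L.dr i → ∀ j, headway d 1 j ≤ L.hMax i

/-- All components of `d` have asymptotic average growth rate `h`: the asymptotic average train
time-headway. -/
def HasAverageHeadway {n : ℕ} (d : ℕ → ZMod n → ℝ) (h : ℝ) : Prop :=
  ∀ j, Tendsto (fun k : ℕ => d k j / (k : ℝ)) atTop (𝓝 h)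

/-- The asymptotic average frequency is the inverse of the asymptotic average headway, which
exists, is common to all nodes, and is positive. -/
def HasAverageFrequency {n : ℕ} (d : ℕ → ZMod n → ℝ) (f : ℝ) : Prop :=
  ∃ h : ℝ, 0 < h ∧ HasAverageHeadway d h ∧ f = 1 / h

/-- The frequency as a function of the number of trains `m` and the demand `X`. -/
def frequencyFormula {n : ℕ} [NeZero n] (gMin rTilde s : ZMod n → ℝ) (m : ℕ) (X : ZMod n → ℝ) :
    ℝ :=
  min ((m : ℝ) / ∑ j, (gMin j * X j + rTilde j))
    (min (1 / Finset.univ.sup' Finset.univ_nonempty (fun j => (gMin j * X j + rTilde j) + s j))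
      (((n : ℝ) - (m : ℝ)) / ∑ j, s j))

end MetroLine

end

namespace MetroLine

/-! The max-plus system is a longest-path recursion whose growth rate is the largest weight-to-lag
ratio of a circuit. With `h` = `criticalHeadway`, write T_j for the nominal travel time. Only three
kinds of circuit matter: following the trains (ΣT over lag m), out and back over one segment (T_j +
s_j over lag 1), and following the free spaces (Σs over lag n − m). Lower bound: go around these
circuits. Upper bound: a potential `v` for which no constraint gains more than lag · `h`; its
increments must lie between T_j − b_j h and (1 − b_j) h − s_j and sum to zero, which is possible
exactly because `h` dominates the three ratios (`exists_subeigenvector`). Constraints of lag zero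
close no circuit, since 0 < m < n (`le_of_lag_zero`). The demand dynamics reduce to this case: below
the maximum headway the run time control cancels the headway in the dwell time, and bounded initial
headways stay bounded (`headway_le`). -/

theorem b_eq_zero_or_one {n : ℕ} (L : MetroLine n) (j : ZMod n) :
    (L.b j = 0 ∧ L.bBar j = 1) ∨ (L.b j = 1 ∧ L.bBar j = 0) := by
  unfold b bBar
  cases L.occupied j <;> simp

/-- A neighbour reached with lag one is covered by the induction hypothesis; the lag-zero cases are
left for `le_of_lag_zero`. -/
theorem exists_lag_zero_of_le {n : ℕ} (L : MetroLine n) {a : ℕ → ZMod n → ℝ} {c : ℝ} {k : ℕ}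
    (ih : ∀ j, a k j ≤ c) {j : ZMod n}
    (h : a (k + 1) j ≤ a (k + 1 - L.b j) (j - 1) ∨
      a (k + 1) j ≤ a (k + 1 - L.bBar (j + 1)) (j + 1)) :
    a (k + 1) j ≤ c ∨ (L.b j = 0 ∧ a (k + 1) j ≤ a (k + 1) (j - 1)) ∨
      (L.b (j + 1) = 1 ∧ a (k + 1) j ≤ a (k + 1) (j + 1)) := by
  rcases h with h | h
  · rcases L.b_eq_zero_or_one j with hb | hb <;> rw [hb.1] at h
    · exact Or.inr (Or.inl ⟨hb.1, h⟩)
    · exact Or.inl (h.trans (ih _))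
  · rcases L.b_eq_zero_or_one (j + 1) with hb | hb <;> rw [hb.2] at h
    · exact Or.inl (h.trans (ih _))
    · exact Or.inr (Or.inr ⟨hb.1, h⟩)

/-! ### Induction, sums and potentials around the loop -/

variable {n : ℕ} [NeZero n]

/-- A property of nodes that is invariant under `j ↦ j + 1` holds everywhere once it holds
somewhere. -/
theorem forall_of_succ {P : ZMod n → Prop} {j : ZMod n} (hj : P j)
    (hstep : ∀ i, P i → P (i + 1)) (i : ZMod n) : P i := by
  have key : ∀ k : ℕ, P (j + (k : ZMod n)) := by
    intro k
    induction k with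
    | zero => simpa using hj
    | succ k ih =>
      have := hstep _ ih
      rwa [add_assoc, ← Nat.cast_succ] at this
  have := key (i - j).val
  rwa [ZMod.natCast_zmod_val, add_sub_cancel] at this

/-- A property of nodes that is invariant under `j ↦ j - 1` holds everywhere once it holds
somewhere. -/
theorem forall_of_pred {P : ZMod n → Prop} {j : ZMod n} (hj : P j)
    (hstep : ∀ i, P i → P (i - 1)) (i : ZMod n) : P i := by
  have := forall_of_succ (P := fun i => P (-i)) (j := -j) (by simpa using hj)
    (fun i hi => by rw [neg_add']; exact hstep _ hi) (-i)
  simpa using this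

theorem sum_range_natCast {M : Type*} [AddCommMonoid M] (f : ZMod n → M) :
    ∑ i ∈ Finset.range n, f (i : ZMod n) = ∑ j, f j := by
  refine Finset.sum_bij' (fun i _ => (i : ZMod n)) (fun j _ => j.val) ?_ ?_ ?_ ?_ ?_
  · simp
  · intro j _
    exact Finset.mem_range.2 (ZMod.val_lt j)
  · intro i hi
    exact ZMod.val_cast_of_lt (Finset.mem_range.1 hi)
  · simp
  · simp

theorem sum_range_add_natCast {M : Type*} [AddCommMonoid M] (f : ZMod n → M) (j : ZMod n) :
    ∑ i ∈ Finset.range n, f (j + (i : ZMod n)) = ∑ j, f j := by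
  rw [sum_range_natCast (fun i => f (j + i))]
  exact Fintype.sum_equiv (Equiv.addLeft j) _ _ (fun _ => rfl)

/-- Increments around the loop with zero sum come from a potential. -/
theorem exists_potential (δ : ZMod n → ℝ) (hδ : ∑ j, δ j = 0) :
    ∃ v : ZMod n → ℝ, ∀ j, v j = v (j - 1) + δ j := by
  -- Partial sums from node 0 through `j`; the zero total is needed only at the wrap-around `j = 0`.
  refine ⟨fun j => ∑ i ∈ Finset.range (j.val + 1), δ (i : ZMod n), fun j => ?_⟩
  obtain ⟨p, hp⟩ := Nat.exists_eq_succ_of_ne_zero (NeZero.ne n)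
  have hval : ∀ a : ℕ, a < n → (a : ZMod n).val = a := fun a ha => ZMod.val_cast_of_lt ha
  rcases Nat.eq_zero_or_pos j.val with h0 | h0
  · have hj : j = 0 := (ZMod.val_eq_zero j).1 h0
    have h1 : (0 - 1 : ZMod n) = (p : ZMod n) := by
      have : ((p + 1 : ℕ) : ZMod n) = 0 := by rw [← Nat.succ_eq_add_one, ← hp]; simp
      push_cast at this
      linear_combination -this
    subst hj
    have h2 : (0 - 1 : ZMod n).val + 1 = n := by rw [h1, hval p (by omega)]; omega
    simp only [h2, sum_range_natCast, hδ, ZMod.val_zero]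
    simp
  · have h1 : j - 1 = ((j.val - 1 : ℕ) : ZMod n) := by
      rw [Nat.cast_sub h0]; simp
    have h2 : (j - 1).val + 1 = j.val := by
      have := ZMod.val_lt j
      rw [h1, hval _ (by omega)]; omega
    simp only [h2, Finset.sum_range_succ, ZMod.natCast_zmod_val]

/-- Between lower bounds with nonpositive sum and upper bounds with nonnegative sum there are
increments with zero sum. -/
theorem exists_between_sum_eq_zero {ι : Type*} [Fintype ι] (lo hi : ι → ℝ)
    (hle : ∀ j, lo j ≤ hi j) (hlo : ∑ j, lo j ≤ 0) (hhi : 0 ≤ ∑ j, hi j) :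
    ∃ δ : ι → ℝ, (∀ j, lo j ≤ δ j ∧ δ j ≤ hi j) ∧ ∑ j, δ j = 0 := by
  rcases hlo.eq_or_lt with h0 | h0
  · exact ⟨lo, fun j => ⟨le_rfl, hle j⟩, h0⟩
  have hpos : 0 < ∑ j, hi j - ∑ j, lo j := by linarith
  -- The weight for which `lo + θ (hi - lo)` has sum zero.
  set θ := -(∑ j, lo j) / (∑ j, hi j - ∑ j, lo j) with hθ
  have hθ0 : 0 ≤ θ := div_nonneg (by linarith) hpos.le
  have hθ1 : θ ≤ 1 := (div_le_one hpos).2 (by linarith)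
  refine ⟨fun j => lo j + θ * (hi j - lo j), fun j => ⟨?_, ?_⟩, ?_⟩
  · have := mul_nonneg hθ0 (sub_nonneg.2 (hle j))
    linarith
  · have := mul_nonneg (sub_nonneg.2 hθ1) (sub_nonneg.2 (hle j))
    linarith
  · rw [Finset.sum_add_distrib, ← Finset.mul_sum, Finset.sum_sub_distrib, hθ,
      div_mul_cancel₀ _ hpos.ne']
    ring

/-! ### Train counts and lag-zero constraints -/

section Segments

variable (L : MetroLine n)

theorem exists_b_eq_one (hm : 0 < L.trains) : ∃ j, L.b j = 1 := by
  by_contra! h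
  have : L.trains = 0 :=
    Finset.sum_eq_zero fun j _ => by
      rcases L.b_eq_zero_or_one j with h0 | h0
      · exact h0.1
      · exact absurd h0.1 (h j)
  omega

theorem sum_bBar_add_trains : ∑ j, L.bBar j + L.trains = n := by
  unfold trains
  rw [← Finset.sum_add_distrib]
  have : ∀ j, L.bBar j + L.b j = 1 := fun j => by
    rcases L.b_eq_zero_or_one j with h | h <;> omega
  simp [this, ZMod.card]

theorem exists_b_eq_zero (hm : L.trains < n) : ∃ j, L.b j = 0 := by
  by_contra! h
  have : ∑ j, L.bBar j = 0 :=
    Finset.sum_eq_zero fun j _ => by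
      rcases L.b_eq_zero_or_one j with h0 | h0
      · exact absurd h0.1 (h j)
      · exact h0.2
  have := L.sum_bBar_add_trains
  omega

/-- The constraints without time lag contain no circuit: a bound that can only be violated at a
node if it is violated at least as much at a node constraining it without lag holds everywhere. -/
theorem le_of_lag_zero (hm_pos : 0 < L.trains) (hm_lt : L.trains < n) (a : ZMod n → ℝ) (c : ℝ)
    (h : ∀ j, a j ≤ c ∨ (L.b j = 0 ∧ a j ≤ a (j - 1)) ∨
      (L.b (j + 1) = 1 ∧ a j ≤ a (j + 1))) (j : ZMod n) : a j ≤ c := by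
  obtain ⟨j₀, -, hmax⟩ := Finset.exists_max_image Finset.univ a Finset.univ_nonempty
  replace hmax : ∀ i, a i ≤ a j₀ := fun i => hmax i (Finset.mem_univ i)
  refine (hmax j).trans ?_
  by_contra! hc
  rcases h j₀ with h0 | ⟨hb, ha⟩ | ⟨hb, ha⟩
  · linarith
  · obtain ⟨i, hi⟩ := L.exists_b_eq_one hm_pos
    -- A maximum above `c` propagates backwards: `b i = 0` excludes the forward alternative at `i -
    -- 1`. Hence no segment would carry a train.
    have key := forall_of_pred (P := fun i => L.b i = 0 ∧ a (i - 1) = a j₀) (j := j₀)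
      ⟨hb, le_antisymm (hmax _) ha⟩ (fun i hi' => by
        rcases h (i - 1) with h1 | h1 | h1
        · linarith [hi'.2]
        · exact ⟨h1.1, le_antisymm (hmax _) (hi'.2 ▸ h1.2)⟩
        · have := h1.1
          rw [sub_add_cancel] at this
          omega) i
    omega
  · obtain ⟨i, hi⟩ := L.exists_b_eq_zero hm_lt
    have key := forall_of_succ (P := fun i => L.b i = 1 ∧ a i = a j₀) (j := j₀ + 1)
      ⟨hb, le_antisymm (hmax _) ha⟩ (fun i hi' => by
        rcases h i with h1 | h1 | h1
        · linarith [hi'.2]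
        · omega
        · exact ⟨h1.1, le_antisymm (hmax _) (hi'.2 ▸ h1.2)⟩) i
    omega

end Segments

/-! ### The critical headway and the frequency formula -/

/-- Nominal travel time on a segment, including the nominal dwell time. -/
noncomputable def nominalTravel (L : MetroLine n) (j : ZMod n) : ℝ := L.gMin j * L.X j + L.rTilde j

/-- The larger of the average headways imposed by the train circuit, by the two-node circuits,
and by the circuit of free spaces. -/
noncomputable def criticalHeadway (L : MetroLine n) : ℝ :=
  max ((∑ j, L.nominalTravel j) / L.trains)
    (max (Finset.univ.sup' Finset.univ_nonempty fun j => L.nominalTravel j + L.s j)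
      ((∑ j, L.s j) / ((n : ℝ) - L.trains)))

namespace Admissible

variable {L : MetroLine n}

theorem x_nonneg (hL : L.Admissible) (j : ZMod n) : 0 ≤ L.x j :=
  add_nonneg
    (div_nonneg (Finset.sum_nonneg fun i _ => hL.demand_nonneg i j) (hL.alphaOut_pos j).le)
    (div_nonneg (Finset.sum_nonneg fun i _ => hL.demand_nonneg j i) (hL.alphaIn_pos j).le)

theorem nominalTravel_nonneg (hL : L.Admissible) (j : ZMod n) : 0 ≤ L.nominalTravel j :=
  add_nonneg (mul_nonneg (hL.gMin_nonneg j)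
    (div_nonneg (hL.x_nonneg j) (sub_pos.2 (hL.x_lt_one j)).le))
    (add_nonneg (hL.rMin_nonneg j) (hL.dr_nonneg j))

theorem frequencyFormula_eq (hL : L.Admissible) (hm_pos : 0 < L.trains) (hm_lt : L.trains < n) :
    0 < L.criticalHeadway ∧
      frequencyFormula L.gMin L.rTilde L.s L.trains L.X = 1 / L.criticalHeadway := by
  have hm : (0 : ℝ) < L.trains := by exact_mod_cast hm_pos
  have hnm : (0 : ℝ) < (n : ℝ) - L.trains := sub_pos.2 (by exact_mod_cast hm_lt)
  have hT : 0 < ∑ j, L.nominalTravel j := hL.sum_travel_pos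
  have hS := hL.sum_s_pos
  have hM : 0 < Finset.univ.sup' Finset.univ_nonempty fun j => L.nominalTravel j + L.s j := by
    obtain ⟨j, -, hj⟩ := Finset.exists_lt_of_sum_lt (f := fun _ : ZMod n => (0 : ℝ))
      (g := L.s) (s := Finset.univ) (by simpa using hS)
    rw [Finset.lt_sup'_iff]
    exact ⟨j, Finset.mem_univ j, add_pos_of_nonneg_of_pos (hL.nominalTravel_nonneg j) hj⟩
  have inv_max : ∀ a b : ℝ, 0 < a → 0 < b → 1 / max a b = min (1 / a) (1 / b) := by
    intro a b ha hb
    rcases le_total a b with h | h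
    · rw [max_eq_right h, min_eq_right (one_div_le_one_div_of_le ha h)]
    · rw [max_eq_left h, min_eq_left (one_div_le_one_div_of_le hb h)]
  refine ⟨lt_max_of_lt_left (div_pos hT hm), ?_⟩
  unfold criticalHeadway
  rw [inv_max _ _ (div_pos hT hm) (lt_max_of_lt_left hM), inv_max _ _ hM (div_pos hS hnm),
    one_div_div, one_div_div]
  rfl

end Admissible

/-! ### Upper bound and circuits for the max-plus system -/

section Linear

variable {L : MetroLine n} {d : ℕ → ZMod n → ℝ}

theorem IsMaxPlusTrajectory.eq_max (hd : L.IsMaxPlusTrajectory d) {k : ℕ} (hk : 1 ≤ k)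
    (j : ZMod n) :
    d k j = max (d (k - L.b j) (j - 1) + L.nominalTravel j)
      (d (k - L.bBar (j + 1)) (j + 1) + L.s (j + 1)) := by
  rw [hd k hk j, nominalTravel]
  congr 1
  ring

/-- The two-node ratios order the increment bounds at each `j`; the train and free-space ratios give
their sums the right signs. -/
theorem exists_subeigenvector (hm_pos : 0 < L.trains) (hm_lt : L.trains < n) :
    ∃ v : ZMod n → ℝ, ∀ j, v (j - 1) + L.nominalTravel j ≤ v j + L.b j * L.criticalHeadway ∧
      v j + L.s j ≤ v (j - 1) + L.bBar j * L.criticalHeadway := by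
  have hm : (0 : ℝ) < L.trains := by exact_mod_cast hm_pos
  have hnm : (0 : ℝ) < (n : ℝ) - L.trains := sub_pos.2 (by exact_mod_cast hm_lt)
  have hbBar : ∑ j, (L.bBar j : ℝ) = (n : ℝ) - L.trains := by
    have : ((∑ j, L.bBar j + L.trains : ℕ) : ℝ) = n := by rw [L.sum_bBar_add_trains]
    push_cast at this
    linarith
  have hb : ∑ j, (L.b j : ℝ) = L.trains := by simp [trains]
  obtain ⟨δ, hδ, hsum⟩ := exists_between_sum_eq_zero
    (fun j => L.nominalTravel j - L.b j * L.criticalHeadway)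
    (fun j => L.bBar j * L.criticalHeadway - L.s j) (fun j => by
      have h1 : L.nominalTravel j + L.s j ≤ L.criticalHeadway :=
        (Finset.le_sup' (fun j => L.nominalTravel j + L.s j) (Finset.mem_univ j)).trans
          ((le_max_left _ _).trans (le_max_right _ _))
      rcases L.b_eq_zero_or_one j with h | h <;> simp only [h.1, h.2] <;> push_cast <;> linarith)
    (by
      have h1 : (∑ j, L.nominalTravel j) / L.trains ≤ L.criticalHeadway := le_max_left _ _
      rw [div_le_iff₀ hm] at h1
      rw [Finset.sum_sub_distrib, ← Finset.sum_mul, hb]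
      linarith)
    (by
      have h1 : (∑ j, L.s j) / ((n : ℝ) - L.trains) ≤ L.criticalHeadway :=
        (le_max_right _ _).trans (le_max_right _ _)
      rw [div_le_iff₀ hnm] at h1
      rw [Finset.sum_sub_distrib, ← Finset.sum_mul, hbBar]
      linarith)
  obtain ⟨v, hv⟩ := exists_potential δ hsum
  refine ⟨v, fun j => ⟨?_, ?_⟩⟩
  · linarith [hv j, (hδ j).1]
  · linarith [hv j, (hδ j).2]

theorem IsMaxPlusTrajectory.exists_le (hd : L.IsMaxPlusTrajectory d) (hm_pos : 0 < L.trains)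
    (hm_lt : L.trains < n) (j : ZMod n) : ∃ C : ℝ, ∀ k, d k j ≤ k * L.criticalHeadway + C := by
  obtain ⟨v, hv⟩ := exists_subeigenvector (L := L) hm_pos hm_lt
  obtain ⟨C, hC⟩ := (Set.finite_range fun j => d 0 j - v j).bddAbove
  replace hC : ∀ j, d 0 j - v j ≤ C := fun j => hC ⟨j, rfl⟩
  have key : ∀ k : ℕ, ∀ j, d k j - v j ≤ k * L.criticalHeadway + C := by
    intro k
    induction k with
    | zero => simpa using hC
    | succ k ih =>
      -- At lag one the induction hypothesis applies; at lag zero `v` absorbs the whole weight, so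
      -- the excess passes to the neighbour.
      refine L.le_of_lag_zero hm_pos hm_lt (fun j => d (k + 1) j - v j) _ fun j => ?_
      have hvj := (hv j).1
      have hvj' := (hv (j + 1)).2
      rw [add_sub_cancel_right] at hvj'
      rcases max_choice (d (k + 1 - L.b j) (j - 1) + L.nominalTravel j)
        (d (k + 1 - L.bBar (j + 1)) (j + 1) + L.s (j + 1)) with h | h
      · have hdj := (hd.eq_max (Nat.le_add_left 1 k) j).trans h
        rcases L.b_eq_zero_or_one j with hb | hb
        · rw [hb.1] at hdj hvj
          refine Or.inr (Or.inl ⟨hb.1, ?_⟩)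
          push_cast at hvj
          simp only [Nat.sub_zero] at hdj
          linarith
        · rw [hb.1] at hdj hvj
          refine Or.inl ?_
          have := ih (j - 1)
          push_cast at hvj ⊢
          simp only [Nat.add_sub_cancel] at hdj
          linarith
      · have hdj := (hd.eq_max (Nat.le_add_left 1 k) j).trans h
        rcases L.b_eq_zero_or_one (j + 1) with hb | hb
        · rw [hb.2] at hdj hvj'
          refine Or.inl ?_
          have := ih (j + 1)
          push_cast at hvj' ⊢
          simp only [Nat.add_sub_cancel] at hdj
          linarith
        · rw [hb.2] at hdj hvj'
          refine Or.inr (Or.inr ⟨hb.1, ?_⟩)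
          push_cast at hvj'
          simp only [Nat.sub_zero] at hdj
          linarith
  exact ⟨C + v j, fun k => by linarith [key k j]⟩

/-- The index grows by the lag of each segment crossed, so every subtraction in the recursion is
exact. -/
theorem IsMaxPlusTrajectory.forward_chain (hd : L.IsMaxPlusTrajectory d) {k : ℕ} (hk : 1 ≤ k)
    (j : ZMod n) (i : ℕ) :
    d k j + ∑ l ∈ Finset.range i, L.nominalTravel (j + 1 + (l : ZMod n)) ≤
      d (k + ∑ l ∈ Finset.range i, L.b (j + 1 + (l : ZMod n))) (j + i) := by
  induction i with
  | zero => simp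
  | succ i ih =>
    rw [Finset.sum_range_succ, Finset.sum_range_succ, ← add_assoc, ← add_assoc k]
    have h := hd.eq_max (k := k + ∑ l ∈ Finset.range i, L.b (j + 1 + (l : ZMod n)) +
      L.b (j + 1 + (i : ZMod n))) (by omega) (j + ((i + 1 : ℕ) : ZMod n))
    have e1 : j + ((i + 1 : ℕ) : ZMod n) = j + 1 + (i : ZMod n) := by push_cast; ring
    have e2 : j + 1 + (i : ZMod n) - 1 = j + i := by ring
    rw [e1, e2, Nat.add_sub_cancel] at h
    rw [e1, h]
    exact le_max_of_le_left (by linarith)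

theorem IsMaxPlusTrajectory.backward_chain (hd : L.IsMaxPlusTrajectory d) {k : ℕ} (hk : 1 ≤ k)
    (j : ZMod n) (i : ℕ) :
    d k j + ∑ l ∈ Finset.range i, L.s (j - (l : ZMod n)) ≤
      d (k + ∑ l ∈ Finset.range i, L.bBar (j - (l : ZMod n))) (j - i) := by
  induction i with
  | zero => simp
  | succ i ih =>
    rw [Finset.sum_range_succ, Finset.sum_range_succ, ← add_assoc, ← add_assoc k]
    have h := hd.eq_max (k := k + ∑ l ∈ Finset.range i, L.bBar (j - (l : ZMod n)) +
      L.bBar (j - (i : ZMod n))) (by omega) (j - ((i + 1 : ℕ) : ZMod n))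
    have e1 : j - ((i + 1 : ℕ) : ZMod n) + 1 = j - (i : ZMod n) := by push_cast; ring
    rw [e1, Nat.add_sub_cancel] at h
    rw [h]
    exact le_max_of_le_right (by linarith)

theorem IsMaxPlusTrajectory.train_circuit (hd : L.IsMaxPlusTrajectory d) {k : ℕ} (hk : 1 ≤ k)
    (j : ZMod n) : d k j + ∑ i, L.nominalTravel i ≤ d (k + L.trains) j := by
  have := hd.forward_chain hk j n
  rw [sum_range_add_natCast L.nominalTravel, sum_range_add_natCast L.b] at this
  simpa [trains] using this

theorem IsMaxPlusTrajectory.space_circuit (hd : L.IsMaxPlusTrajectory d) {k : ℕ} (hk : 1 ≤ k)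
    (j : ZMod n) : d k j + ∑ i, L.s i ≤ d (k + (n - L.trains)) j := by
  have hsum : ∀ {M : Type} [AddCommMonoid M] (f : ZMod n → M),
      ∑ l ∈ Finset.range n, f (j - (l : ZMod n)) = ∑ i, f i := by
    intro M _ f
    rw [sum_range_natCast (fun i => f (j - i))]
    exact Fintype.sum_equiv (Equiv.subLeft j) _ _ (fun _ => rfl)
  have := hd.backward_chain hk j n
  rw [hsum, hsum] at this
  have h2 := L.sum_bBar_add_trains
  have h3 : ∑ i, L.bBar i = n - L.trains := by omega
  rw [h3] at this
  simpa using this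

theorem IsMaxPlusTrajectory.two_node_circuit (hd : L.IsMaxPlusTrajectory d) {k : ℕ} (hk : 1 ≤ k)
    (j : ZMod n) : d k j + (L.nominalTravel j + L.s j) ≤ d (k + 1) j := by
  have h1 := hd.backward_chain hk j 1
  have h2 := hd.forward_chain (k := k + L.bBar j) (by omega) (j - 1) 1
  simp only [Finset.sum_range_one, Nat.cast_zero, sub_zero, Nat.cast_one, add_zero,
    sub_add_cancel] at h1 h2
  have h3 : k + L.bBar j + L.b j = k + 1 := by
    rcases L.b_eq_zero_or_one j with h | h <;> omega
  rw [h3] at h2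
  linarith

end Linear

/-! ### Growth rates and part 1 -/

/-- A sequence that grows by at least `c` over `p` steps grows at least at the rate `c / p`. -/
theorem exists_linear_lower_bound {u : ℕ → ℝ} {p : ℕ} (hp : 0 < p) {c : ℝ}
    (hu : ∀ k, 1 ≤ k → u k + c ≤ u (k + p)) : ∃ C : ℝ, ∀ k, k * (c / p) ≤ u k + C := by
  -- The base range includes `p`, because `hu` is not available at index 0.
  obtain ⟨C, hC⟩ := ((Finset.range (p + 1)).image fun k => k * (c / p) - u k).bddAbove
  replace hC : ∀ k ≤ p, k * (c / p) - u k ≤ C := fun k hk =>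
    hC (Finset.mem_coe.2 (Finset.mem_image.2 ⟨k, Finset.mem_range.2 (by omega), rfl⟩))
  refine ⟨C, fun k => ?_⟩
  induction k using Nat.strong_induction_on with
  | _ k ih =>
    rcases le_or_gt k p with hk | hk
    · linarith [hC k hk]
    · have h1 := hu (k - p) (by omega)
      have h2 := ih (k - p) (by omega)
      rw [Nat.sub_add_cancel hk.le] at h1
      have hp' : (p : ℝ) ≠ 0 := by exact_mod_cast hp.ne'
      rw [Nat.cast_sub hk.le, sub_mul, mul_div_cancel₀ _ hp'] at h2
      linarith

theorem tendsto_div_natCast_of_bounds {u : ℕ → ℝ} {h C C' : ℝ}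
    (hlow : ∀ᶠ k : ℕ in atTop, k * h ≤ u k + C') (hup : ∀ k : ℕ, u k ≤ k * h + C) :
    Tendsto (fun k : ℕ => u k / (k : ℝ)) atTop (𝓝 h) := by
  have hlim : ∀ c : ℝ, Tendsto (fun k : ℕ => h + c / (k : ℝ)) atTop (𝓝 h) := fun c => by
    simpa using (tendsto_const_div_atTop_nhds_zero_nat c).const_add h
  refine tendsto_of_tendsto_of_tendsto_of_le_of_le' (hlim (-C')) (hlim C) ?_ ?_
  · filter_upwards [hlow, eventually_gt_atTop 0] with k hk hk0
    have : (0 : ℝ) < k := by exact_mod_cast hk0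
    rw [le_div_iff₀ this, add_mul, div_mul_cancel₀ _ this.ne']
    linarith
  · filter_upwards [eventually_gt_atTop 0] with k hk0
    have : (0 : ℝ) < k := by exact_mod_cast hk0
    rw [div_le_iff₀ this, add_mul, div_mul_cancel₀ _ this.ne']
    linarith [hup k]

variable {L : MetroLine n} {d : ℕ → ZMod n → ℝ}

/-- A linear lower bound at one node spreads to all nodes. -/
theorem IsMaxPlusTrajectory.spread_lower_bound (hL : L.Admissible) (hd : L.IsMaxPlusTrajectory d)
    {j : ZMod n} {h C : ℝ} (hC : ∀ k : ℕ, k * h ≤ d k j + C) (i : ZMod n) :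
    ∃ C' : ℝ, ∀ᶠ k : ℕ in atTop, k * h ≤ d k i + C' := by
  set B := ∑ l ∈ Finset.range (i - j).val, L.b (j + 1 + (l : ZMod n)) with hB
  refine ⟨C + B * h, ?_⟩
  -- The chain must start at index `k - B ≥ 1`.
  filter_upwards [eventually_gt_atTop B] with k hk
  have h1 := hd.forward_chain (k := k - B) (by omega) j (i - j).val
  rw [← hB, Nat.sub_add_cancel hk.le, ZMod.natCast_zmod_val, add_sub_cancel] at h1
  have h2 : 0 ≤ ∑ l ∈ Finset.range (i - j).val, L.nominalTravel (j + 1 + (l : ZMod n)) :=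
    Finset.sum_nonneg fun l _ => hL.nominalTravel_nonneg _
  have h3 := hC (k - B)
  rw [Nat.cast_sub hk.le] at h3
  linarith

theorem IsMaxPlusTrajectory.exists_ge (hL : L.Admissible) (hd : L.IsMaxPlusTrajectory d)
    (hm_pos : 0 < L.trains) (hm_lt : L.trains < n) (i : ZMod n) :
    ∃ C : ℝ, ∀ᶠ k : ℕ in atTop, k * L.criticalHeadway ≤ d k i + C := by
  unfold criticalHeadway
  -- Each candidate is proved separately; the two-node bound is first obtained at a maximizing node
  -- only.
  refine max_rec' (fun h : ℝ => ∃ C : ℝ, ∀ᶠ k : ℕ in atTop, k * h ≤ d k i + C) ?_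
    (max_rec' (fun h : ℝ => ∃ C : ℝ, ∀ᶠ k : ℕ in atTop, k * h ≤ d k i + C) ?_ ?_)
  · obtain ⟨C, hC⟩ := exists_linear_lower_bound (u := fun k => d k i) hm_pos
      fun k hk => hd.train_circuit hk i
    exact ⟨C, Eventually.of_forall hC⟩
  · obtain ⟨j, -, hj⟩ := Finset.exists_mem_eq_sup' Finset.univ_nonempty
      fun j => L.nominalTravel j + L.s j
    rw [hj]
    obtain ⟨C, hC⟩ := exists_linear_lower_bound (u := fun k => d k j) one_pos
      fun k hk => hd.two_node_circuit hk j
    simp only [Nat.cast_one, div_one] at hC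
    exact hd.spread_lower_bound hL hC i
  · obtain ⟨C, hC⟩ := exists_linear_lower_bound (u := fun k => d k i) (Nat.sub_pos_of_lt hm_lt)
      fun k hk => hd.space_circuit hk i
    rw [Nat.cast_sub hm_lt.le] at hC
    exact ⟨C, Eventually.of_forall hC⟩

theorem IsMaxPlusTrajectory.hasAverageFrequency (hL : L.Admissible)
    (hd : L.IsMaxPlusTrajectory d) (hm_pos : 0 < L.trains) (hm_lt : L.trains < n) :
    HasAverageFrequency d (frequencyFormula L.gMin L.rTilde L.s L.trains L.X) := by
  obtain ⟨hpos, heq⟩ := hL.frequencyFormula_eq hm_pos hm_lt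
  refine ⟨L.criticalHeadway, hpos, fun j => ?_, heq⟩
  obtain ⟨C, hC⟩ := hd.exists_le hm_pos hm_lt j
  obtain ⟨C', hC'⟩ := hd.exists_ge hL hm_pos hm_lt j
  exact tendsto_div_natCast_of_bounds hC' hC

/-! ### Reduction of the demand-dependent dynamics -/

theorem Admissible.nominalTravel_eq (hL : L.Admissible) (j : ZMod n) :
    L.nominalTravel j = L.rMin j + L.dr j + L.x j * L.hMin j := by
  have : 1 - L.x j ≠ 0 := (sub_pos.2 (hL.x_lt_one j)).ne'
  unfold nominalTravel rTilde X hMin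
  field_simp
  ring

/-- The dwell cap is inactive, and the margin condition keeps the run time above its floor, so the
terms in `h` cancel. -/
theorem Admissible.travelTime_eq_of_le (hL : L.Admissible) (hM : L.MarginCondition) {j : ZMod n}
    {h : ℝ} (hh : h ≤ L.hMax j) : L.travelTime j h = L.nominalTravel j := by
  have h1 := mul_le_mul_of_nonneg_left hh (hL.x_nonneg j)
  have h2 := hM j
  rw [hL.nominalTravel_eq]
  unfold dw wMax wMin at h2
  unfold travelTime runTime dwellTime wMax
  rw [min_eq_left h1, max_eq_right (by linarith)]
  ring

theorem Admissible.travelTime_le (hL : L.Admissible) (hM : L.MarginCondition) (j : ZMod n)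
    (h : ℝ) : L.travelTime j h ≤ L.nominalTravel j := by
  rcases le_total h (L.hMax j) with hh | hh
  · exact (hL.travelTime_eq_of_le hM hh).le
  · have h1 := mul_le_mul_of_nonneg_left hh (hL.x_nonneg j)
    have h2 := hM j
    rw [hL.nominalTravel_eq]
    unfold dw wMax wMin at h2
    unfold travelTime runTime dwellTime wMax
    rw [min_eq_right h1, ← max_add_add_right]
    exact max_le (by linarith) (by linarith)

/-- Without excess margin, or without demand, the travel time does not depend on the headway. -/
theorem Admissible.travelTime_eq_of_not (hL : L.Admissible) (hM : L.MarginCondition) {j : ZMod n}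
    (hj : ¬(0 < L.x j ∧ L.dw j < L.dr j)) (h : ℝ) : L.travelTime j h = L.nominalTravel j := by
  refine le_antisymm (hL.travelTime_le hM j h) ?_
  rcases le_total h (L.hMax j) with hh | hh
  · exact (hL.travelTime_eq_of_le hM hh).ge
  · have h1 := mul_le_mul_of_nonneg_left hh (hL.x_nonneg j)
    rw [hL.nominalTravel_eq]
    unfold travelTime runTime dwellTime
    rcases (hL.x_nonneg j).eq_or_lt with hx | hx
    · simp [← hx, wMax]
    · have h2 : L.dr j ≤ L.dw j := not_lt.1 fun hlt => hj ⟨hx, hlt⟩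
      unfold dw wMax wMin at h2
      unfold wMax
      rw [min_eq_right h1]
      linarith [le_max_left (L.rMin j) (L.rMin j + L.dr j - L.x j * (h - L.hMin j))]

/-- A common bound on the headways that keeps the travel times nominal is preserved by the
demand-dependent dynamics. -/
theorem IsDemandTrajectory.headway_le (hL : L.Admissible) (hM : L.MarginCondition)
    (hm_pos : 0 < L.trains) (hm_lt : L.trains < n) (hd : L.IsDemandTrajectory d) {c : ℝ}
    (hc : ∀ j h, h ≤ c → L.travelTime j h = L.nominalTravel j) (h1 : ∀ j, headway d 1 j ≤ c)
    (k : ℕ) (j : ZMod n) : headway d (k + 1) j ≤ c := by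
  induction k generalizing j with
  | zero => exact h1 j
  | succ k ih =>
    refine L.le_of_lag_zero hm_pos hm_lt (headway d (k + 1 + 1)) c (fun j => ?_) j
    refine L.exists_lag_zero_of_le (a := headway d) ih ?_
    have hb : L.b j ≤ 1 := by rcases L.b_eq_zero_or_one j with h | h <;> omega
    have hbBar : L.bBar (j + 1) ≤ 1 := by
      rcases L.b_eq_zero_or_one (j + 1) with h | h <;> omega
    have e1 : k + 1 + 1 - L.b j - 1 = k + 1 - L.b j := by omega
    have e2 : k + 1 + 1 - L.bBar (j + 1) - 1 = k + 1 - L.bBar (j + 1) := by omega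
    have hprev := hd (k + 1) (by omega) j
    rw [hc j _ (ih j)] at hprev
    have hnext := hd (k + 1 + 1) (by omega) j
    -- Subtracting consecutive steps along the active constraint: the earlier travel time is
    -- nominal, the later one at most nominal.
    have hT := hL.travelTime_le hM j (headway d (k + 1 + 1) j)
    unfold headway at hT hnext ⊢
    rw [e1, e2, Nat.add_sub_cancel]
    rw [Nat.add_sub_cancel] at hT hnext
    rcases max_choice (d (k + 1 + 1 - L.b j) (j - 1) +
        L.travelTime j (d (k + 1 + 1) j - d (k + 1) j))
      (d (k + 1 + 1 - L.bBar (j + 1)) (j + 1) + L.s (j + 1)) with h | h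
    · have hn := hnext.trans h
      have hp := hprev.ge.trans' (le_max_left _ _)
      exact Or.inl (by linarith)
    · have hn := hnext.trans h
      have hp := hprev.ge.trans' (le_max_right _ _)
      exact Or.inr (by linarith)

/-- Under the margin condition and the initial headway condition, the demand-dependent dynamics
coincide with the max-plus linear dynamics. -/
theorem IsDemandTrajectory.isMaxPlusTrajectory (hL : L.Admissible) (hM : L.MarginCondition)
    (hm_pos : 0 < L.trains) (hm_lt : L.trains < n) (hd : L.IsDemandTrajectory d)
    (h1 : L.InitialHeadwayCondition d) : L.IsMaxPlusTrajectory d := by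
  suffices h : ∀ k j, 1 ≤ k → L.travelTime j (headway d k j) = L.nominalTravel j by
    intro k hk j
    rw [hd k hk j, h k j hk, nominalTravel]
    congr 1
    ring
  intro k j hk
  by_cases hne : ∃ i, 0 < L.x i ∧ L.dw i < L.dr i
  -- The smallest relevant `hMax` is a headway bound valid at all nodes.
  · obtain ⟨i, hi, hmin⟩ := Set.exists_min_image {i | 0 < L.x i ∧ L.dw i < L.dr i} L.hMax
      (Set.toFinite _) hne
    have hc : ∀ j h, h ≤ L.hMax i → L.travelTime j h = L.nominalTravel j := fun j h hh => by
      by_cases hj : 0 < L.x j ∧ L.dw j < L.dr j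
      · exact hL.travelTime_eq_of_le hM (hh.trans (hmin j hj))
      · exact hL.travelTime_eq_of_not hM hj h
    obtain ⟨k, rfl⟩ := Nat.exists_eq_add_of_le' hk
    exact hc j _ (hd.headway_le hL hM hm_pos hm_lt hc (h1 i hi.1 hi.2) k j)
  · exact hL.travelTime_eq_of_not hM (fun hj => hne ⟨j, hj⟩) _

end MetroLine

theorem mainTheorem8 (n : ℕ) [NeZero n] (L : MetroLine n) (hL : L.Admissible)
    (hm_pos : 0 < L.trains) (hm_lt : L.trains < n) :
    (∀ d : ℕ → ZMod n → ℝ, L.IsMaxPlusTrajectory d →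
      MetroLine.HasAverageFrequency d
        (MetroLine.frequencyFormula L.gMin L.rTilde L.s L.trains L.X)) ∧
    (L.MarginCondition → ∀ d : ℕ → ZMod n → ℝ, L.IsDemandTrajectory d →
      L.InitialHeadwayCondition d →
      MetroLine.HasAverageFrequency d
        (MetroLine.frequencyFormula L.gMin L.rTilde L.s L.trains L.X)) :=
  ⟨fun _ hd => hd.hasAverageFrequency hL hm_pos hm_lt,
    fun hM _ hd h1 =>
      (hd.isMaxPlusTrajectory hL hM hm_pos hm_lt h1).hasAverageFrequency hL hm_pos hm_lt⟩
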